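/- Let $N\ge 1$ be an integer and let $0<s<1$, $N>2s$ and $p>\frac{N}{N-2s}$. Write $$(-\Delta)^s u(x)=C_{N,s}\,\lim_{\varepsilon\to0^+}\int_{\{|x-y|\ge\varepsilon\}}\frac{u(x)-u(y)}{|x-y|^{N+2s}}\,dy,\qquad C_{N,s}=\frac{s\,4^s\,\Gamma(\frac N2+s)}{\pi^{N/2}\,\Gamma(1-s)},$$ let $B_{R_0}$ be the open ball of radius $R_0$ centred at $0$, and call $u:\mathbb{R}^N\to\mathbb{R}$ a classical supersolution of $$(-\Delta)^s u+|\nabla u|^q=\lambda u^p\quad\text{in }\mathbb{R}^N\setminus B_{R_0}\qquad(\ast)$$ if $u$ is measurable with $\int_{\mathbb{R}^N}\frac{|u(x)|}{1+|x|^{N+2s}}\,dx<\infty$, $u$ is of class $C^2$ in a neighbourhood of $\mathbb{R}^N\setminus B_{R_0}$, and at every $x\in\mathbb{R}^N\setminus B_{R_0}$ the limit $(-\Delta)^s u(x)$ exists, with absolutely convergent truncated integrals, and $(-\Delta)^s u(x)+|\nabla u(x)|^q\ge\lambda u(x)^p$. Then there is a positive bounded function $u:\mathbb{R}^N\to\mathbb{R}$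 that is a classical supersolution of $(\ast)$ for all $q\ge0$, all $\lambda\le1$ and all $R_0>0$. More precisely, the interval $\left(\frac1{p-1},\frac{N-2s}{2s}\right)$ is non-empty, and for every $\beta$ in it there is a constant $C>0$ such that the positive bounded function $v_\beta(x)=C(1+|x|)^{-2s\beta}$ is a classical supersolution of $(\ast)$ for all $q\ge0$, all $\lambda\le1$ and all $R_0>0$. -/

import Mathlib

open scoped Topology

noncomputable section

/-- The normalization constant `C_{N,s} = s 4^s Γ(N/2 + s) / (π^(N/2) Γ(1 - s))` for which the
fractional Laplacian has Fourier symbol `|ξ|^(2s)`. -/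
def fracLapConst (N : ℕ) (s : ℝ) : ℝ :=
  s * (4 : ℝ) ^ s * Real.Gamma ((N : ℝ) / 2 + s) /
    (Real.pi ^ ((N : ℝ) / 2) * Real.Gamma (1 - s))

/-- `HasFracLap s u x L` says that `(-Δ)^s u (x)` exists and equals `L`, where
`(-Δ)^s u (x) = C_{N,s} P.V. ∫ (u x - u y) / |x - y|^(N + 2s) dy`:
the truncated integrals over the complements of the balls `B_ε(x)` converge absolutely, and
they tend to `L` (after normalization) as `ε → 0+`. -/
def HasFracLap {N : ℕ} (s : ℝ) (u : EuclideanSpace ℝ (Fin N) → ℝ)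
    (x : EuclideanSpace ℝ (Fin N)) (L : ℝ) : Prop :=
  (∀ ε : ℝ, 0 < ε → MeasureTheory.IntegrableOn
      (fun y => (u x - u y) / ‖x - y‖ ^ ((N : ℝ) + 2 * s)) (Metric.ball x ε)ᶜ) ∧
  Filter.Tendsto
    (fun ε : ℝ => fracLapConst N s *
      ∫ y in (Metric.ball x ε)ᶜ, (u x - u y) / ‖x - y‖ ^ ((N : ℝ) + 2 * s))
    (𝓝[>] 0) (𝓝 L)

/-- The weighted space `𝓛_{2s}`: measurable functions with
`∫ |u x| / (1 + |x|^(N + 2s)) dx < ∞`. -/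
def MemL2s {N : ℕ} (s : ℝ) (u : EuclideanSpace ℝ (Fin N) → ℝ) : Prop :=
  MeasureTheory.Integrable (fun x => u x / (1 + ‖x‖ ^ ((N : ℝ) + 2 * s)))

/-- Classical supersolution of `(-Δ)^s u + |∇u|^q = lam * f u` in `ℝ^N ∖ B_{R₀}`, where `B_{R₀}`
is the open ball with centre `0`: `u` belongs to `𝓛_{2s}`, is of class `C²` in a neighbourhood of
every point of the closed set `ℝ^N ∖ B_{R₀}`, and the inequality
`(-Δ)^s u + |∇u|^q ≥ lam * f u` holds at every point of this set (in particular `(-Δ)^s u`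
exists there). -/
structure IsClassicalSupersolution {N : ℕ} (s q lam : ℝ) (f : ℝ → ℝ) (R₀ : ℝ)
    (u : EuclideanSpace ℝ (Fin N) → ℝ) : Prop where
  memL2s : MemL2s s u
  contDiffAt : ∀ x ∈ (Metric.ball (0 : EuclideanSpace ℝ (Fin N)) R₀)ᶜ, ContDiffAt ℝ 2 u x
  ineq : ∀ x ∈ (Metric.ball (0 : EuclideanSpace ℝ (Fin N)) R₀)ᶜ,
    ∃ L : ℝ, HasFracLap s u x L ∧ lam * f (u x) ≤ L + ‖gradient u x‖ ^ q

end

/-!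
Fix `x` and pair each `y` outside the sphere `‖y‖ = ‖x‖` with its inversion in that sphere. Writing
`τ = ‖x‖ / ‖y‖`, the Jacobian of the inversion is `τ ^ (2 * N)` and the distance to `x` shrinks by
the factor `τ`, so the inner point enters the principal value with weight `τ ^ (N - 2 * s)` relative
to the outer one. For the profile `(1 + t) ^ (-a)` with `a ≤ N - 2 * s`, convexity of `t ^ (-a)`
makes every pair contribute nonnegatively, while the pairs with `‖y‖` comparable to a large multiple
of `1 + ‖x‖` contribute at least a constant times `(1 + ‖x‖) ^ (-a - 2 * s)`. Hence
`(-Δ)^s (1 + ‖x‖) ^ (-a) ≥ c * (1 + ‖x‖) ^ (-a - 2 * s)`, which dominates the `p`-th power of a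
suitable multiple as soon as `a * (p - 1) ≥ 2 * s`.
-/

section PrincipalValue

open MeasureTheory Metric Set Filter Module

lemma aecover_compl_ball_nhdsGT_zero {X : Type*} [MetricSpace X] [MeasurableSpace X]
    [OpensMeasurableSpace X] (μ : Measure X) [NullSingletonClass μ] (x : X) :
    AECover μ (𝓝[>] (0 : ℝ)) fun ε => (ball x ε)ᶜ where
  ae_eventually_mem := by
    filter_upwards [compl_mem_ae_iff.2 (measure_singleton x)] with y hy
    filter_upwards [Ioo_mem_nhdsGT (dist_pos.2 hy)] with ε hε
    simpa using hε.2.le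
  measurableSet _ := measurableSet_ball.compl

lemma exists_norm_second_difference_le {E F : Type*} [NormedAddCommGroup E] [NormedSpace ℝ E]
    [NormedAddCommGroup F] [NormedSpace ℝ F] {u : E → F} {x : E} (hu : ContDiffAt ℝ 2 u x) :
    ∃ K δ : ℝ, 0 < δ ∧
      ∀ h ∈ ball (0 : E) δ, ‖u (x + h) + u (x - h) - (2 : ℝ) • u x‖ ≤ K * ‖h‖ ^ 2 := by
  obtain ⟨K, t, ht, hK⟩ := (hu.fderiv_right (m := 1) (by norm_num)).exists_lipschitzOnWith
  have hdiff : ∀ᶠ y in 𝓝 x, DifferentiableAt ℝ u y :=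
    (hu.eventually (by simp)).mono fun y hy => hy.differentiableAt (by simp)
  obtain ⟨δ, hδ, hball⟩ := Metric.mem_nhds_iff.1 (inter_mem ht hdiff)
  refine ⟨2 * K, δ, hδ, fun h hh => ?_⟩
  have hadd : ∀ k ∈ closedBall (0 : E) ‖h‖, x + k ∈ t ∩ {y | DifferentiableAt ℝ u y} :=
    fun k hk => hball <| by
      simpa using (mem_closedBall_zero_iff.1 hk).trans_lt (mem_ball_zero_iff.1 hh)
  have hsub : ∀ k ∈ closedBall (0 : E) ‖h‖, x - k ∈ t ∩ {y | DifferentiableAt ℝ u y} :=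
    fun k hk => by simpa [sub_eq_add_neg] using hadd (-k) (by simpa using hk)
  have hderiv : ∀ k ∈ closedBall (0 : E) ‖h‖, HasFDerivWithinAt (fun k => u (x + k) + u (x - k))
      (fderiv ℝ u (x + k) - fderiv ℝ u (x - k)) (closedBall 0 ‖h‖) k := fun k hk => by
    have h₁ := (hadd k hk).2.hasFDerivAt.comp k ((hasFDerivAt_id k).const_add x)
    have h₂ := (hsub k hk).2.hasFDerivAt.comp k ((hasFDerivAt_id k).const_sub x)
    simpa [Function.comp_def, sub_eq_add_neg] using (h₁.fun_add h₂).hasFDerivWithinAt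
  have hbound : ∀ k ∈ closedBall (0 : E) ‖h‖,
      ‖fderiv ℝ u (x + k) - fderiv ℝ u (x - k)‖ ≤ 2 * K * ‖h‖ := fun k hk => by
    calc ‖fderiv ℝ u (x + k) - fderiv ℝ u (x - k)‖ ≤ K * ‖(x + k) - (x - k)‖ :=
          hK.norm_sub_le (hadd k hk).1 (hsub k hk).1
      _ = 2 * K * ‖k‖ := by
          rw [add_sub_sub_cancel, ← two_smul ℝ k, norm_smul, Real.norm_two]
          ring
      _ ≤ 2 * K * ‖h‖ := by
          gcongr
          exact mem_closedBall_zero_iff.1 hk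
  have hmvt := (convex_closedBall (0 : E) ‖h‖).norm_image_sub_le_of_norm_hasFDerivWithin_le
    hderiv hbound (mem_closedBall_self (norm_nonneg h)) (y := h) (by simp)
  simpa [two_smul, sq, mul_assoc] using hmvt

variable {E F : Type*} [NormedAddCommGroup E] [NormedSpace ℝ E] [FiniteDimensional ℝ E]
  [MeasurableSpace E] [BorelSpace E] {μ : Measure E} [μ.IsAddHaarMeasure]

lemma tendsto_setIntegral_compl_ball_of_integrable_add_comp_neg [Nontrivial E]
    [NormedAddCommGroup F] [NormedSpace ℝ F] {g : E → F}
    (hg : ∀ ε > 0, IntegrableOn g (ball 0 ε)ᶜ μ) (hsymm : Integrable (fun h => g h + g (-h)) μ) :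
    Tendsto (fun ε => ∫ h in (ball 0 ε)ᶜ, g h ∂μ) (𝓝[>] 0)
      (𝓝 ((2⁻¹ : ℝ) • ∫ h, (g h + g (-h)) ∂μ)) := by
  refine (((aecover_compl_ball_nhdsGT_zero μ 0).integral_tendsto_of_countably_generated
    hsymm).const_smul (2⁻¹ : ℝ)).congr' (eventually_nhdsWithin_of_forall fun ε hε => ?_)
  have hpre : (fun h : E => -h) ⁻¹' (ball 0 ε)ᶜ = (ball 0 ε)ᶜ := by ext; simp
  have hmp := Measure.measurePreserving_neg μ
  have hemb := (MeasurableEquiv.neg E).measurableEmbedding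
  have hneg : IntegrableOn (fun h => g (-h)) (ball 0 ε)ᶜ μ := by
    simpa only [hpre, Function.comp_def] using (hmp.integrableOn_comp_preimage hemb).2 (hg ε hε)
  have hint : ∫ h in (ball 0 ε)ᶜ, g (-h) ∂μ = ∫ h in (ball 0 ε)ᶜ, g h ∂μ := by
    simpa only [hpre] using hmp.setIntegral_preimage_emb hemb g (ball 0 ε)ᶜ
  rw [integral_add (hg ε hε) hneg, hint, ← two_smul ℝ, inv_smul_smul₀ two_ne_zero]

lemma integrableOn_inv_norm_rpow_compl_ball {α ε : ℝ} (hα : finrank ℝ E < α) (hε : 0 < ε) :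
    IntegrableOn (fun h : E => (‖h‖ ^ α)⁻¹) (ball 0 ε)ᶜ μ := by
  have hα₀ : 0 ≤ α := (Nat.cast_nonneg _).trans hα.le
  refine ((integrable_one_add_norm (μ := μ) hα).const_mul ((1 + 1 / ε) ^ α)).integrableOn.mono'
    (by fun_prop) ((ae_restrict_iff' measurableSet_ball.compl).2 (.of_forall fun h hh => ?_))
  have hεh : ε ≤ ‖h‖ := by simpa using hh
  have hpos : 0 < ‖h‖ := hε.trans_le hεh
  have hle : 1 + ‖h‖ ≤ (1 + 1 / ε) * ‖h‖ := by
    have : 1 ≤ 1 / ε * ‖h‖ := by rwa [one_div_mul_eq_div, one_le_div hε]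
    linarith
  rw [Real.norm_of_nonneg (by positivity), Real.rpow_neg (by positivity), ← div_eq_mul_inv,
    inv_le_comm₀ (by positivity) (by positivity), inv_div, div_le_iff₀ (by positivity), mul_comm,
    ← Real.mul_rpow (by positivity) hpos.le]
  exact Real.rpow_le_rpow (by positivity) hle hα₀

lemma integrableOn_div_norm_rpow_compl_ball {w : E → ℝ} {α ε M : ℝ} (hα : finrank ℝ E < α)
    (hε : 0 < ε) (hw : AEStronglyMeasurable w μ) (hM : ∀ h, |w h| ≤ M) :
    IntegrableOn (fun h => w h / ‖h‖ ^ α) (ball 0 ε)ᶜ μ :=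
  (integrableOn_inv_norm_rpow_compl_ball hα hε).bdd_mul hw.restrict (.of_forall hM)

lemma integrableOn_div_norm_rpow_ball [Nontrivial E] {w : E → ℝ} {α β δ K : ℝ}
    (hα : α < finrank ℝ E + β) (hw : AEStronglyMeasurable w μ)
    (hK : ∀ h ∈ ball (0 : E) δ, |w h| ≤ K * ‖h‖ ^ β) :
    IntegrableOn (fun h => w h / ‖h‖ ^ α) (ball 0 δ) μ := by
  refine integrableOn_ball_of_norm_le_rpow (C := K) (α := α - β) finrank_pos (by linarith) ?_
    (hw.div₀ (g := fun h => ‖h‖ ^ α) (Measurable.aestronglyMeasurable (by fun_prop)))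
  filter_upwards [ae_restrict_mem measurableSet_ball,
    ae_restrict_of_ae (compl_mem_ae_iff.2 (measure_singleton 0))] with h hh h_ne
  have hpos : 0 < ‖h‖ := norm_pos_iff.2 h_ne
  rw [norm_div, Real.norm_of_nonneg (by positivity : 0 ≤ ‖h‖ ^ α), div_le_iff₀ (by positivity),
    mul_assoc, ← Real.rpow_add hpos, neg_sub, sub_add_cancel]
  exact hK h hh

lemma integrable_div_norm_rpow [Nontrivial E] {w : E → ℝ} {α β δ K M : ℝ}
    (hα : finrank ℝ E < α) (hαβ : α < finrank ℝ E + β) (hδ : 0 < δ)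
    (hw : AEStronglyMeasurable w μ) (hM : ∀ h, |w h| ≤ M)
    (hK : ∀ h ∈ ball (0 : E) δ, |w h| ≤ K * ‖h‖ ^ β) :
    Integrable (fun h => w h / ‖h‖ ^ α) μ := by
  rw [← integrableOn_univ, ← union_compl_self (ball 0 δ)]
  exact (integrableOn_div_norm_rpow_ball hαβ hw hK).union
    (integrableOn_div_norm_rpow_compl_ball hα hδ hw hM)

lemma integrable_inv_one_add_norm_rpow {α : ℝ} (hα : finrank ℝ E < α) :
    Integrable (fun x : E => (1 + ‖x‖ ^ α)⁻¹) μ := by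
  rw [← integrableOn_univ, ← union_compl_self (ball 0 1)]
  have hmeas : AEStronglyMeasurable (fun x : E => (1 + ‖x‖ ^ α)⁻¹) μ :=
    Measurable.aestronglyMeasurable (by fun_prop)
  have hpow : ∀ x : E, 0 ≤ ‖x‖ ^ α := fun x => by positivity
  refine IntegrableOn.union ?_ ?_
  · refine Measure.integrableOn_of_bounded (M := 1) measure_ball_lt_top.ne hmeas
      (.of_forall fun x => ?_)
    rw [Real.norm_of_nonneg (by positivity)]
    exact inv_le_one_of_one_le₀ (by linarith [hpow x])
  · refine (integrableOn_inv_norm_rpow_compl_ball hα one_pos).mono' hmeas.restrict ?_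
    filter_upwards [ae_restrict_mem measurableSet_ball.compl] with x hx
    have hx₁ : 1 ≤ ‖x‖ := by simpa using hx
    rw [Real.norm_of_nonneg (by positivity)]
    gcongr
    linarith

end PrincipalValue

section SubLeft

open MeasureTheory Metric Set

variable {E : Type*} [NormedAddCommGroup E] [MeasurableSpace E] [BorelSpace E] {μ : Measure E}
  [μ.IsAddLeftInvariant] [μ.IsNegInvariant]

lemma preimage_sub_left_compl_ball {E : Type*} [SeminormedAddCommGroup E] (x : E) (ε : ℝ) :
    (fun h => x - h) ⁻¹' (ball x ε)ᶜ = (ball 0 ε)ᶜ := by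
  ext h
  simp [dist_eq_norm]

lemma integrableOn_compl_ball_comp_sub_left {F : Type*} [NormedAddCommGroup F] {g : E → F}
    {x : E} {ε : ℝ} :
    IntegrableOn (fun h => g (x - h)) (ball 0 ε)ᶜ μ ↔ IntegrableOn g (ball x ε)ᶜ μ := by
  simpa only [preimage_sub_left_compl_ball, Function.comp_def] using
    (Measure.measurePreserving_sub_left μ x).integrableOn_comp_preimage
      (MeasurableEquiv.subLeft x).measurableEmbedding (f := g) (s := (ball x ε)ᶜ)

lemma setIntegral_compl_ball_comp_sub_left {F : Type*} [NormedAddCommGroup F] [NormedSpace ℝ F]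
    (g : E → F) (x : E) (ε : ℝ) :
    ∫ h in (ball 0 ε)ᶜ, g (x - h) ∂μ = ∫ y in (ball x ε)ᶜ, g y ∂μ := by
  simpa only [preimage_sub_left_compl_ball] using
    (Measure.measurePreserving_sub_left μ x).setIntegral_preimage_emb
      (MeasurableEquiv.subLeft x).measurableEmbedding g (ball x ε)ᶜ

end SubLeft

section FractionalLaplacian

open MeasureTheory Metric Set Filter Module

variable {E : Type*} [NormedAddCommGroup E] [NormedSpace ℝ E] [FiniteDimensional ℝ E]
  [MeasurableSpace E] [BorelSpace E] {μ : Measure E} [μ.IsAddHaarMeasure]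

lemma integrableOn_sub_div_norm_sub_rpow_compl_ball {u : E → ℝ} {α ε M : ℝ}
    (hα : finrank ℝ E < α) (hε : 0 < ε) (hu : AEStronglyMeasurable u μ) (hM : ∀ y, |u y| ≤ M)
    (x : E) : IntegrableOn (fun y => (u x - u y) / ‖x - y‖ ^ α) (ball x ε)ᶜ μ := by
  rw [← integrableOn_compl_ball_comp_sub_left]
  simp only [sub_sub_cancel]
  exact integrableOn_div_norm_rpow_compl_ball hα hε
    (aestronglyMeasurable_const.sub
      (hu.comp_measurePreserving (Measure.measurePreserving_sub_left μ x)))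
    fun h => (abs_sub _ _).trans (add_le_add (hM x) (hM (x - h)))

lemma exists_tendsto_setIntegral_sub_div_norm_sub_rpow [Nontrivial E] {u : E → ℝ} {x : E}
    {α M : ℝ} (hα : finrank ℝ E < α) (hα₂ : α < finrank ℝ E + 2) (hu : AEStronglyMeasurable u μ)
    (hM : ∀ y, |u y| ≤ M) (hx : ContDiffAt ℝ 2 u x) :
    ∃ L, Tendsto (fun ε => ∫ y in (ball x ε)ᶜ, (u x - u y) / ‖x - y‖ ^ α ∂μ) (𝓝[>] 0) (𝓝 L) := by
  obtain ⟨K, δ, hδ, hK⟩ := exists_norm_second_difference_le hx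
  have hsub : AEStronglyMeasurable (fun h => u (x - h)) μ :=
    hu.comp_measurePreserving (Measure.measurePreserving_sub_left μ x)
  have hadd : AEStronglyMeasurable (fun h => u (x + h)) μ :=
    hu.comp_measurePreserving (measurePreserving_add_left μ x)
  have hsymm : Integrable (fun h => -(u (x + h) + u (x - h) - 2 * u x) / ‖h‖ ^ α) μ := by
    refine integrable_div_norm_rpow (β := 2) (M := M + M + 2 * M) (K := K) hα hα₂ hδ
      ((hadd.add hsub).sub aestronglyMeasurable_const).neg (fun h => ?_) fun h hh => ?_
    · rw [abs_neg]
      refine (abs_sub _ _).trans (add_le_add ((abs_add_le _ _).trans (add_le_add (hM _) (hM _))) ?_)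
      rw [abs_mul, abs_two]
      exact mul_le_mul_of_nonneg_left (hM x) zero_le_two
    · rw [abs_neg, Real.rpow_two]
      exact hK h hh
  have hpv := tendsto_setIntegral_compl_ball_of_integrable_add_comp_neg (μ := μ)
    (g := fun h => (u x - u (x - h)) / ‖x - (x - h)‖ ^ α)
    (fun ε hε => integrableOn_compl_ball_comp_sub_left.2
      (integrableOn_sub_div_norm_sub_rpow_compl_ball hα hε hu hM x))
    (hsymm.congr (.of_forall fun h => by
      simp only [sub_sub_cancel, sub_neg_eq_add, sub_add_cancel_left, norm_neg, ← add_div]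
      ring))
  exact ⟨_, hpv.congr fun ε =>
    setIntegral_compl_ball_comp_sub_left (fun y => (u x - u y) / ‖x - y‖ ^ α) x ε⟩

variable {N : ℕ} {s : ℝ} {u : EuclideanSpace ℝ (Fin N) → ℝ} {x : EuclideanSpace ℝ (Fin N)}

lemma fracLapConst_pos (N : ℕ) (hs₀ : 0 < s) (hs₁ : s < 1) : 0 < fracLapConst N s := by
  unfold fracLapConst
  exact div_pos (mul_pos (by positivity) (Real.Gamma_pos_of_pos (by positivity)))
    (mul_pos (by positivity) (Real.Gamma_pos_of_pos (by linarith)))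

lemma exists_hasFracLap [NeZero N] (hs₀ : 0 < s) (hs₁ : s < 1) {M : ℝ}
    (hu : AEStronglyMeasurable u) (hM : ∀ y, |u y| ≤ M) (hx : ContDiffAt ℝ 2 u x) :
    ∃ L, HasFracLap s u x L := by
  have hα : (finrank ℝ (EuclideanSpace ℝ (Fin N)) : ℝ) < N + 2 * s := by
    simpa using hs₀
  have hα₂ : N + 2 * s < (finrank ℝ (EuclideanSpace ℝ (Fin N)) : ℝ) + 2 := by
    simpa using hs₁
  obtain ⟨L, hL⟩ := exists_tendsto_setIntegral_sub_div_norm_sub_rpow hα hα₂ hu hM hx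
  exact ⟨_, fun ε hε => integrableOn_sub_div_norm_sub_rpow_compl_ball hα hε hu hM x,
    hL.const_mul (fracLapConst N s)⟩

lemma HasFracLap.const_mul {L : ℝ} (h : HasFracLap s u x L) (C : ℝ) :
    HasFracLap s (fun y => C * u y) x (C * L) := by
  unfold HasFracLap
  simp only [← mul_sub, mul_div_assoc, integral_const_mul, mul_left_comm (fracLapConst N s) C]
  exact ⟨fun ε hε => (h.1 ε hε).const_mul C, h.2.const_mul C⟩

lemma memL2s_of_bounded (hs : 0 < s) {M : ℝ} (hu : AEStronglyMeasurable u)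
    (hM : ∀ y, |u y| ≤ M) : MemL2s s u :=
  (integrable_inv_one_add_norm_rpow (by simpa using hs)).bdd_mul hu (.of_forall hM)

end FractionalLaplacian

section Inversion

open MeasureTheory Module EuclideanGeometry

variable {E : Type*} [NormedAddCommGroup E] [InnerProductSpace ℝ E]

lemma norm_inversion_zero (R : ℝ) (z : E) : ‖inversion 0 R z‖ = R * (R / ‖z‖) := by
  rw [← dist_zero_right, dist_inversion_center, dist_zero_right]
  ring

lemma norm_sub_inversion_zero_norm (x : E) {z : E} (hz : z ≠ 0) :
    ‖x - inversion 0 ‖x‖ z‖ = ‖x‖ / ‖z‖ * ‖x - z‖ := by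
  rcases eq_or_ne x 0 with rfl | hx
  · simp
  have h := dist_inversion_mul_dist_center_eq (R := ‖x‖) hx hz
  rw [inversion_of_mem_sphere (by simp), dist_zero_right, dist_zero_right, dist_eq_norm,
    dist_eq_norm, mul_comm ‖x - z‖] at h
  rw [div_mul_eq_mul_div, eq_div_iff (norm_ne_zero_iff.2 hz), h]

variable [FiniteDimensional ℝ E]

lemma abs_det_fderiv_inversion (c z : E) (R : ℝ) :
    |((R / dist z c) ^ 2 • ((ℝ ∙ (z - c))ᗮ.reflection : E →L[ℝ] E)).det| =
      (|R| / dist z c) ^ (2 * finrank ℝ E) := by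
  have h : LinearMap.det (((ℝ ∙ (z - c))ᗮ.reflection : E →L[ℝ] E) : E →ₗ[ℝ] E) =
      (-1) ^ finrank ℝ (ℝ ∙ (z - c))ᗮᗮ := Submodule.det_reflection _
  rw [ContinuousLinearMap.det, ContinuousLinearMap.toLinearMap_smul, LinearMap.det_smul, h]
  simp [abs_mul, abs_pow, abs_div, pow_mul]

variable [MeasurableSpace E] [BorelSpace E] {μ : Measure E} [μ.IsAddHaarMeasure]
  {F : Type*} [NormedAddCommGroup F] [NormedSpace ℝ F] {c : E} {R : ℝ} {S : Set E}

lemma integrableOn_image_inversion_iff (hR : R ≠ 0) (hS : MeasurableSet S) (hc : c ∉ S)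
    (f : E → F) :
    IntegrableOn f (inversion c R '' S) μ ↔
      IntegrableOn (fun z => (|R| / dist z c) ^ (2 * finrank ℝ E) • f (inversion c R z)) S μ := by
  simpa only [abs_det_fderiv_inversion] using
    integrableOn_image_iff_integrableOn_abs_det_fderiv_smul μ hS
      (fun z hz => (hasFDerivAt_inversion (ne_of_mem_of_not_mem hz hc)).hasFDerivWithinAt)
      (inversion_injective c hR).injOn f

lemma setIntegral_image_inversion (hR : R ≠ 0) (hS : MeasurableSet S) (hc : c ∉ S) (f : E → F) :
    ∫ y in inversion c R '' S, f y ∂μ =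
      ∫ z in S, (|R| / dist z c) ^ (2 * finrank ℝ E) • f (inversion c R z) ∂μ := by
  simpa only [abs_det_fderiv_inversion] using
    integral_image_eq_integral_abs_det_fderiv_smul μ hS
      (fun z hz => (hasFDerivAt_inversion (ne_of_mem_of_not_mem hz hc)).hasFDerivWithinAt)
      (inversion_injective c hR).injOn f

end Inversion

section ReflectedExterior

open MeasureTheory Metric Set Module EuclideanGeometry

variable {E : Type*} [NormedAddCommGroup E] [InnerProductSpace ℝ E] {x : E} {ε : ℝ}

/-- The points outside the sphere `‖z‖ = ‖x‖` whose inversion in that sphere is at distance at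
least `ε` from `x`. Inversion carries this set onto the part of the truncated domain
`(ball x ε)ᶜ` inside the sphere, up to the origin. -/
def reflectedExterior (x : E) (ε : ℝ) : Set E :=
  {z | ‖x‖ < ‖z‖ ∧ ε ≤ ‖x - inversion 0 ‖x‖ z‖}

lemma ne_zero_of_mem_reflectedExterior {z : E} (hz : z ∈ reflectedExterior x ε) : z ≠ 0 :=
  norm_pos_iff.1 ((norm_nonneg x).trans_lt hz.1)

lemma inversion_image_reflectedExterior (hx : x ≠ 0) (ε : ℝ) :
    inversion 0 ‖x‖ '' reflectedExterior x ε = ((ball x ε)ᶜ ∩ ball 0 ‖x‖) \ {0} := by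
  have hr : ‖x‖ ≠ 0 := norm_ne_zero_iff.2 hx
  rw [(inversion_involutive (0 : E) hr).image_eq_preimage_symm]
  ext y
  rcases eq_or_ne y 0 with rfl | hy
  · simp [reflectedExterior]
  have hlt : ‖x‖ < ‖x‖ * (‖x‖ / ‖y‖) ↔ ‖y‖ < ‖x‖ := by
    rw [lt_mul_iff_one_lt_right (norm_pos_iff.2 hx), one_lt_div (norm_pos_iff.2 hy)]
  simp [reflectedExterior, norm_inversion_zero, inversion_inversion _ hr, hlt, hy, dist_eq_norm,
    norm_sub_rev y, and_comm]

lemma reflectedExterior_subset : reflectedExterior x ε ⊆ (ball x ε)ᶜ \ ball 0 ‖x‖ := by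
  rintro z hz
  have hτ : ‖x‖ / ‖z‖ ≤ 1 := div_le_one_of_le₀ hz.1.le (norm_nonneg z)
  have hε : ε ≤ ‖x - z‖ := calc
    ε ≤ ‖x‖ / ‖z‖ * ‖x - z‖ :=
      hz.2.trans_eq (norm_sub_inversion_zero_norm x (ne_zero_of_mem_reflectedExterior hz))
    _ ≤ ‖x - z‖ := mul_le_of_le_one_left (norm_nonneg _) hτ
  simpa [dist_eq_norm, norm_sub_rev z] using ⟨hε, hz.1.le⟩

variable [FiniteDimensional ℝ E] [MeasurableSpace E] [BorelSpace E] {μ : Measure E}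
  [μ.IsAddHaarMeasure]

lemma measurableSet_reflectedExterior : MeasurableSet (reflectedExterior x ε) := by
  have hmeas : Measurable fun z : E => ‖x - inversion 0 ‖x‖ z‖ := by
    unfold inversion
    simp only [vsub_eq_sub, vadd_eq_add]
    fun_prop
  exact (measurableSet_lt measurable_const measurable_norm).inter
    (measurableSet_le measurable_const hmeas)

lemma setIntegral_reflectedExterior_le {f : E → ℝ} (hx : x ≠ 0) (hf : IntegrableOn f (ball x ε)ᶜ μ)
    (hf₀ : ∀ y, ‖x‖ ≤ ‖y‖ → 0 ≤ f y) :
    IntegrableOn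
      (fun z => f z + (‖x‖ / ‖z‖) ^ (2 * finrank ℝ E) * f (inversion 0 ‖x‖ z))
      (reflectedExterior x ε) μ ∧
    ∫ z in reflectedExterior x ε,
      (f z + (‖x‖ / ‖z‖) ^ (2 * finrank ℝ E) * f (inversion 0 ‖x‖ z)) ∂μ ≤
      ∫ y in (ball x ε)ᶜ, f y ∂μ := by
  have : Nontrivial E := nontrivial_of_ne x 0 hx
  have hr : ‖x‖ ≠ 0 := norm_ne_zero_iff.2 hx
  have h0 : (0 : E) ∉ reflectedExterior x ε := fun h => ne_zero_of_mem_reflectedExterior h rfl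
  have himage := inversion_image_reflectedExterior hx ε
  have hin : IntegrableOn (fun z => (‖x‖ / ‖z‖) ^ (2 * finrank ℝ E) * f (inversion 0 ‖x‖ z))
      (reflectedExterior x ε) μ := by
    have hiff := integrableOn_image_inversion_iff (μ := μ) hr measurableSet_reflectedExterior h0 f
    simp only [himage, abs_norm, dist_zero_right, smul_eq_mul] at hiff
    exact hiff.1 (hf.mono_set (sdiff_subset.trans inter_subset_left))
  have hinner : ∫ z in reflectedExterior x ε,
      (‖x‖ / ‖z‖) ^ (2 * finrank ℝ E) * f (inversion 0 ‖x‖ z) ∂μ =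
      ∫ y in (ball x ε)ᶜ ∩ ball 0 ‖x‖, f y ∂μ := by
    have hint := setIntegral_image_inversion (μ := μ) hr measurableSet_reflectedExterior h0 f
    simp only [himage, abs_norm, dist_zero_right, smul_eq_mul] at hint
    rw [← hint]
    exact setIntegral_congr_set (sdiff_null_ae_eq_self (measure_singleton 0))
  have hout : IntegrableOn f (reflectedExterior x ε) μ :=
    hf.mono_set (reflectedExterior_subset.trans sdiff_subset)
  have houter : ∫ z in reflectedExterior x ε, f z ∂μ ≤ ∫ y in (ball x ε)ᶜ \ ball 0 ‖x‖, f y ∂μ := by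
    refine setIntegral_mono_set (hf.mono_set sdiff_subset) ?_ reflectedExterior_subset.eventuallyLE
    filter_upwards [ae_restrict_mem (measurableSet_ball.compl.diff measurableSet_ball)] with y hy
    exact hf₀ y (by simpa using hy.2)
  refine ⟨hout.add hin, ?_⟩
  rw [integral_add hout hin, hinner, add_comm, ← integral_inter_add_sdiff measurableSet_ball hf]
  exact add_le_add_right houter _

end ReflectedExterior

section KelvinGain

open MeasureTheory Metric Set Module EuclideanGeometry

/-- The net contribution to `∫ (φ ‖x‖ - φ ‖y‖) / ‖x - y‖ ^ α` of a point `y` with `‖y‖ = r / τ` and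
of its inversion in the sphere of radius `r = ‖x‖`, where `φ` is a radial profile and
`γ = 2 d - α` in dimension `d`; the common factor `‖x - y‖ ^ (-α)` is left out. -/
noncomputable def kelvinGain (φ : ℝ → ℝ) (γ r τ : ℝ) : ℝ :=
  φ r - φ (r / τ) - τ ^ γ * (φ (r * τ) - φ r)

variable {E : Type*} [NormedAddCommGroup E] [InnerProductSpace ℝ E] {x : E} {φ : ℝ → ℝ} {α : ℝ}

lemma add_inversion_eq_kelvinGain_div {z : E} (hx : x ≠ 0) (hz : z ≠ 0) (n : ℕ) :
    (φ ‖x‖ - φ ‖z‖) / ‖x - z‖ ^ α + (‖x‖ / ‖z‖) ^ (2 * n) *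
        ((φ ‖x‖ - φ ‖inversion 0 ‖x‖ z‖) / ‖x - inversion 0 ‖x‖ z‖ ^ α) =
      kelvinGain φ (2 * n - α) ‖x‖ (‖x‖ / ‖z‖) / ‖x - z‖ ^ α := by
  have hr : 0 < ‖x‖ := norm_pos_iff.2 hx
  rw [kelvinGain, norm_inversion_zero, norm_sub_inversion_zero_norm x hz, div_div_cancel₀ hr.ne']
  set τ := ‖x‖ / ‖z‖
  have hτ : 0 < τ := div_pos hr (norm_pos_iff.2 hz)
  have hpow : τ ^ (2 * n) = τ ^ (2 * n - α) * τ ^ α := by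
    rw [← Real.rpow_add hτ, sub_add_cancel, ← Real.rpow_natCast]
    push_cast
    rfl
  rw [Real.mul_rpow hτ.le (norm_nonneg _), hpow, ← mul_div_assoc, mul_right_comm,
    mul_comm (τ ^ α) (‖x - z‖ ^ α), mul_div_mul_right _ _ (by positivity), ← add_div]
  ring

variable [FiniteDimensional ℝ E] [MeasurableSpace E] [BorelSpace E] {μ : Measure E}
  [μ.IsAddHaarMeasure] {ε : ℝ}

lemma setIntegral_kelvinGain_le (hφ : AntitoneOn φ (Ici 0)) (hx : x ≠ 0)
    (hint : IntegrableOn (fun y => (φ ‖x‖ - φ ‖y‖) / ‖x - y‖ ^ α) (ball x ε)ᶜ μ) :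
    IntegrableOn
      (fun z => kelvinGain φ (2 * finrank ℝ E - α) ‖x‖ (‖x‖ / ‖z‖) / ‖x - z‖ ^ α)
      (reflectedExterior x ε) μ ∧
    ∫ z in reflectedExterior x ε,
      kelvinGain φ (2 * finrank ℝ E - α) ‖x‖ (‖x‖ / ‖z‖) / ‖x - z‖ ^ α ∂μ ≤
      ∫ y in (ball x ε)ᶜ, (φ ‖x‖ - φ ‖y‖) / ‖x - y‖ ^ α ∂μ := by
  have hpair : EqOn (fun z => (φ ‖x‖ - φ ‖z‖) / ‖x - z‖ ^ α + (‖x‖ / ‖z‖) ^ (2 * finrank ℝ E) *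
        ((φ ‖x‖ - φ ‖inversion 0 ‖x‖ z‖) / ‖x - inversion 0 ‖x‖ z‖ ^ α))
      (fun z => kelvinGain φ (2 * finrank ℝ E - α) ‖x‖ (‖x‖ / ‖z‖) / ‖x - z‖ ^ α)
      (reflectedExterior x ε) := fun z hz =>
    add_inversion_eq_kelvinGain_div hx (ne_zero_of_mem_reflectedExterior hz) _
  rw [← integrableOn_congr_fun hpair measurableSet_reflectedExterior,
    ← setIntegral_congr_fun measurableSet_reflectedExterior hpair]
  exact setIntegral_reflectedExterior_le hx hint fun y hy =>
    div_nonneg (sub_nonneg.2 (hφ (norm_nonneg x) (norm_nonneg y) hy)) (by positivity)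

end KelvinGain

section PowerProfile

open MeasureTheory Metric Set Filter Module EuclideanGeometry

variable {a γ r τ M : ℝ}

lemma convexOn_rpow_neg (ha : 0 ≤ a) : ConvexOn ℝ (Ioi 0) fun t : ℝ => t ^ (-a) := by
  refine ⟨convex_Ioi 0, fun x (hx : 0 < x) y (hy : 0 < y) v w hv hw hvw => ?_⟩
  have hgeom : 0 < x ^ v * y ^ w := by positivity
  calc (v * x + w * y) ^ (-a) ≤ (x ^ v * y ^ w) ^ (-a) :=
        Real.rpow_le_rpow_of_nonpos hgeom
          (Real.geom_mean_le_arith_mean2_weighted hv hw hx.le hy.le hvw) (neg_nonpos.2 ha)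
    _ = (x ^ (-a)) ^ v * (y ^ (-a)) ^ w := by
        rw [Real.mul_rpow (by positivity) (by positivity), ← Real.rpow_mul hx.le,
          ← Real.rpow_mul hy.le, mul_comm v, mul_comm w, Real.rpow_mul hx.le, Real.rpow_mul hy.le]
    _ ≤ v * x ^ (-a) + w * y ^ (-a) :=
        Real.geom_mean_le_arith_mean2_weighted hv hw (by positivity) (by positivity) hvw

lemma antitoneOn_one_add_rpow_neg (ha : 0 ≤ a) :
    AntitoneOn (fun t : ℝ => (1 + t) ^ (-a)) (Ici 0) := fun t (ht : 0 ≤ t) _ _ htu =>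
  Real.rpow_le_rpow_of_nonpos (by positivity) (by gcongr) (neg_nonpos.2 ha)

lemma abs_one_add_norm_rpow_neg_le_one {E : Type*} [SeminormedAddCommGroup E] (ha : 0 ≤ a)
    (x : E) : |(1 + ‖x‖) ^ (-a)| ≤ 1 := by
  rw [abs_of_nonneg (by positivity)]
  exact Real.rpow_le_one_of_one_le_of_nonpos (by simp) (neg_nonpos.2 ha)

lemma add_rpow_neg_add_one_add_mul_rpow_neg_le (ha : 0 ≤ a) (hr : 0 ≤ r) (hτ : 0 < τ) :
    (τ + r) ^ (-a) + (1 + r * τ) ^ (-a) ≤ (τ * (1 + r)) ^ (-a) + (1 + r) ^ (-a) := by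
  have hr' : 0 < 1 + r := by positivity
  -- `τ + r` and `1 + r * τ` are the two complementary convex combinations of `τ * (1 + r)` and
  -- `1 + r`, so the weights add up to one on each endpoint.
  have hA : τ * (1 + r) ∈ Ioi (0 : ℝ) := mul_pos hτ hr'
  have hw : 1 / (1 + r) + r / (1 + r) = 1 := by field_simp
  have h₁ := (convexOn_rpow_neg ha).2 hA hr' (by positivity) (by positivity) hw
  have h₂ := (convexOn_rpow_neg ha).2 hr' hA (by positivity) (by positivity) hw
  simp only [smul_eq_mul] at h₁ h₂
  rw [show 1 / (1 + r) * (τ * (1 + r)) + r / (1 + r) * (1 + r) = τ + r by field_simp] at h₁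
  rw [show 1 / (1 + r) * (1 + r) + r / (1 + r) * (τ * (1 + r)) = 1 + r * τ by field_simp] at h₂
  linear_combination h₁ + h₂ + ((τ * (1 + r)) ^ (-a) + (1 + r) ^ (-a)) * hw

lemma kelvinGain_one_add_rpow_neg_nonneg (ha : 0 ≤ a) (haγ : a ≤ γ) (hr : 0 ≤ r) (hτ : 0 < τ)
    (hτ₁ : τ ≤ 1) : 0 ≤ kelvinGain (fun t => (1 + t) ^ (-a)) γ r τ := by
  have hscale : ∀ t, 0 ≤ t → τ ^ a * (τ * t) ^ (-a) = t ^ (-a) := fun t ht => by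
    rw [Real.mul_rpow hτ.le ht, ← mul_assoc, ← Real.rpow_add hτ, add_neg_cancel, Real.rpow_zero,
      one_mul]
  have hself : 0 ≤ kelvinGain (fun t => (1 + t) ^ (-a)) a r τ := by
    have h := mul_le_mul_of_nonneg_left (add_rpow_neg_add_one_add_mul_rpow_neg_le ha hr hτ)
      (Real.rpow_nonneg hτ.le a)
    rw [show τ + r = τ * (1 + r / τ) by field_simp, mul_add (τ ^ a), mul_add (τ ^ a),
      hscale _ (by positivity), hscale _ (by positivity)] at h
    unfold kelvinGain
    linarith
  have hpow : τ ^ γ ≤ τ ^ a := Real.rpow_le_rpow_of_exponent_ge hτ hτ₁ haγ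
  have hinner : 0 ≤ (1 + r * τ) ^ (-a) - (1 + r) ^ (-a) := sub_nonneg.2
    (antitoneOn_one_add_rpow_neg ha (mul_nonneg hr hτ.le) hr (mul_le_of_le_one_right hr hτ₁))
  refine hself.trans ?_
  unfold kelvinGain
  gcongr

lemma le_kelvinGain_one_add_rpow_neg (ha : 0 ≤ a) (haγ : a ≤ γ) (hr : 0 ≤ r) (hτ : 0 < τ)
    (hM : 1 ≤ M) (hMr : M * (1 + r) ≤ r / τ) :
    (1 - M ^ (-a) - M ^ (-(γ - a))) * (1 + r) ^ (-a) ≤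
      kelvinGain (fun t => (1 + t) ^ (-a)) γ r τ := by
  have hM₀ : 0 < M := by linarith
  have hτM : τ ≤ M⁻¹ := by
    rw [le_div_iff₀ hτ] at hMr
    rw [← one_div, le_div_iff₀ hM₀]
    nlinarith [mul_pos hM₀ hτ]
  have houter : (1 + r / τ) ^ (-a) ≤ M ^ (-a) * (1 + r) ^ (-a) := by
    rw [← Real.mul_rpow hM₀.le (by positivity)]
    exact Real.rpow_le_rpow_of_nonpos (by positivity) (by linarith) (neg_nonpos.2 ha)
  have hinner : τ ^ γ * (1 + r * τ) ^ (-a) ≤ M ^ (-(γ - a)) * (1 + r) ^ (-a) := calc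
    τ ^ γ * (1 + r * τ) ^ (-a) ≤ τ ^ γ * (τ * (1 + r)) ^ (-a) := by
      have hle : τ * (1 + r) ≤ 1 + r * τ := by
        linarith [hτM.trans (inv_le_one_of_one_le₀ hM)]
      exact mul_le_mul_of_nonneg_left
        (Real.rpow_le_rpow_of_nonpos (by positivity) hle (neg_nonpos.2 ha)) (by positivity)
    _ = τ ^ (γ - a) * (1 + r) ^ (-a) := by
      rw [Real.mul_rpow hτ.le (by positivity), ← mul_assoc, ← Real.rpow_add hτ, sub_eq_add_neg]
    _ ≤ M⁻¹ ^ (γ - a) * (1 + r) ^ (-a) := by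
      have : 0 ≤ γ - a := sub_nonneg.2 haγ
      gcongr
    _ = M ^ (-(γ - a)) * (1 + r) ^ (-a) := by
      rw [Real.inv_rpow hM₀.le, Real.rpow_neg hM₀.le]
  have hrest : 0 ≤ τ ^ γ * (1 + r) ^ (-a) := by positivity
  unfold kelvinGain
  linarith

lemma exists_rpow_neg_add_rpow_neg_lt_one {a b : ℝ} (ha : 0 < a) (hb : 0 < b) :
    ∃ M : ℝ, 2 ≤ M ∧ M ^ (-a) + M ^ (-b) < 1 := by
  have hlim : Tendsto (fun M : ℝ => M ^ (-a) + M ^ (-b)) atTop (𝓝 0) := by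
    simpa using (tendsto_rpow_neg_atTop ha).add (tendsto_rpow_neg_atTop hb)
  exact ((eventually_ge_atTop 2).and (hlim.eventually_lt_const one_pos)).exists

variable {E : Type*} [NormedAddCommGroup E] [InnerProductSpace ℝ E] {x z z₀ : E}

lemma norm_bounds_of_mem_ball {E : Type*} [SeminormedAddCommGroup E] {x z z₀ : E}
    (hz₀ : ‖z₀‖ = (M + 1) * (1 + ‖x‖)) (hz : z ∈ ball z₀ (1 + ‖x‖)) :
    M * (1 + ‖x‖) ≤ ‖z‖ ∧ ‖x - z‖ ≤ (M + 3) * (1 + ‖x‖) := by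
  rw [mem_ball_iff_norm] at hz
  have hlow := norm_sub_norm_le z₀ z
  have hhigh := norm_sub_norm_le z z₀
  have hdist := norm_sub_le x z
  rw [norm_sub_rev] at hlow
  constructor <;> linarith

lemma ball_subset_reflectedExterior {ε : ℝ} (hM : 2 ≤ M) (hε : ε ≤ ‖x‖ / 2)
    (hz₀ : ‖z₀‖ = (M + 1) * (1 + ‖x‖)) : ball z₀ (1 + ‖x‖) ⊆ reflectedExterior x ε := by
  intro z hz
  have hfar : 2 * (1 + ‖x‖) ≤ ‖z‖ :=
    (mul_le_mul_of_nonneg_right hM (by positivity)).trans (norm_bounds_of_mem_ball hz₀ hz).1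
  have hx := norm_nonneg x
  have hz_pos : 0 < ‖z‖ := by linarith
  have hhalf : ‖z‖ / 2 ≤ ‖x - z‖ := by
    have := norm_sub_norm_le z x
    rw [norm_sub_rev] at this
    linarith
  refine ⟨by linarith, ?_⟩
  calc ε ≤ ‖x‖ / ‖z‖ * (‖z‖ / 2) := hε.trans_eq (by field_simp)
    _ ≤ ‖x‖ / ‖z‖ * ‖x - z‖ := by gcongr
    _ = ‖x - inversion 0 ‖x‖ z‖ := (norm_sub_inversion_zero_norm x (norm_pos_iff.1 hz_pos)).symm

lemma le_kelvinGain_div_norm_sub_rpow {α : ℝ} (ha : 0 ≤ a) (haγ : a ≤ γ) (hα : 0 ≤ α)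
    (hM : 2 ≤ M) (hMa : M ^ (-a) + M ^ (-(γ - a)) ≤ 1) (hx : x ≠ 0)
    (hz₀ : ‖z₀‖ = (M + 1) * (1 + ‖x‖)) (hz : z ∈ ball z₀ (1 + ‖x‖)) :
    (1 - M ^ (-a) - M ^ (-(γ - a))) * (1 + ‖x‖) ^ (-a) / ((M + 3) * (1 + ‖x‖)) ^ α ≤
      kelvinGain (fun t => (1 + t) ^ (-a)) γ ‖x‖ (‖x‖ / ‖z‖) / ‖x - z‖ ^ α := by
  obtain ⟨hfar, hnear⟩ := norm_bounds_of_mem_ball hz₀ hz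
  have hr : 0 < ‖x‖ := norm_pos_iff.2 hx
  have hxz : ‖x‖ < ‖z‖ := (ball_subset_reflectedExterior hM le_rfl hz₀ hz).1
  have hsub : 0 < ‖x - z‖ := norm_pos_iff.2 (sub_ne_zero.2 (ne_of_apply_ne norm hxz.ne))
  have hgain := le_kelvinGain_one_add_rpow_neg (M := M) (τ := ‖x‖ / ‖z‖) ha haγ hr.le
    (div_pos hr (hr.trans hxz)) (by linarith) (by rwa [div_div_cancel₀ hr.ne'])
  have hκ : 0 ≤ 1 - M ^ (-a) - M ^ (-(γ - a)) := by linarith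
  exact div_le_div₀ ((mul_nonneg hκ (by positivity)).trans hgain) hgain (by positivity)
    (Real.rpow_le_rpow hsub.le hnear hα)

variable [FiniteDimensional ℝ E] [MeasurableSpace E] [BorelSpace E]

lemma setIntegral_ball_kelvinGain_le {μ : Measure E} [μ.IsAddHaarMeasure] {α ε : ℝ} (ha : 0 ≤ a)
    (hα : finrank ℝ E < α) (haα : a ≤ 2 * finrank ℝ E - α) (hM : 2 ≤ M) (hx : x ≠ 0)
    (hε₀ : 0 < ε) (hε : ε ≤ ‖x‖ / 2) (hz₀ : ‖z₀‖ = (M + 1) * (1 + ‖x‖)) :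
    IntegrableOn (fun z => kelvinGain (fun t => (1 + t) ^ (-a)) (2 * finrank ℝ E - α) ‖x‖
      (‖x‖ / ‖z‖) / ‖x - z‖ ^ α) (ball z₀ (1 + ‖x‖)) μ ∧
    ∫ z in ball z₀ (1 + ‖x‖), kelvinGain (fun t => (1 + t) ^ (-a)) (2 * finrank ℝ E - α) ‖x‖
      (‖x‖ / ‖z‖) / ‖x - z‖ ^ α ∂μ ≤
      ∫ y in (ball x ε)ᶜ, ((1 + ‖x‖) ^ (-a) - (1 + ‖y‖) ^ (-a)) / ‖x - y‖ ^ α ∂μ := by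
  obtain ⟨hint, hle⟩ := setIntegral_kelvinGain_le (μ := μ) (antitoneOn_one_add_rpow_neg ha) hx
    (integrableOn_sub_div_norm_sub_rpow_compl_ball hα hε₀
      (Measurable.aestronglyMeasurable (by fun_prop)) (abs_one_add_norm_rpow_neg_le_one ha) x)
  have hsubset := ball_subset_reflectedExterior hM hε hz₀
  refine ⟨hint.mono_set hsubset, (setIntegral_mono_set hint ?_ hsubset.eventuallyLE).trans hle⟩
  filter_upwards [ae_restrict_mem measurableSet_reflectedExterior] with z hz
  have hr : 0 < ‖x‖ := norm_pos_iff.2 hx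
  exact div_nonneg (kelvinGain_one_add_rpow_neg_nonneg ha haα hr.le
    (div_pos hr (hr.trans hz.1)) (div_le_one_of_le₀ hz.1.le (norm_nonneg z))) (by positivity)

lemma exists_forall_le_setIntegral_sub_div_norm_sub_rpow (μ : Measure E) [μ.IsAddHaarMeasure]
    {α : ℝ} (ha : 0 < a) (hα : finrank ℝ E < α) (haα : a < 2 * finrank ℝ E - α) :
    ∃ c : ℝ, 0 < c ∧ ∀ x : E, x ≠ 0 → ∀ ε ∈ Ioc 0 (‖x‖ / 2),
      c * (1 + ‖x‖) ^ (finrank ℝ E - a - α) ≤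
        ∫ y in (ball x ε)ᶜ, ((1 + ‖x‖) ^ (-a) - (1 + ‖y‖) ^ (-a)) / ‖x - y‖ ^ α ∂μ := by
  obtain ⟨M, hM, hMa⟩ := exists_rpow_neg_add_rpow_neg_lt_one ha (sub_pos.2 haα)
  have hω : 0 < μ.real (ball (0 : E) 1) :=
    ENNReal.toReal_pos (measure_ball_pos _ _ one_pos).ne' measure_ball_lt_top.ne
  set κ := 1 - M ^ (-a) - M ^ (-(2 * finrank ℝ E - α - a))
  have hκ : 0 < κ := by simp only [κ]; linarith
  refine ⟨κ * μ.real (ball (0 : E) 1) / (M + 3) ^ α, by positivity, fun x hx ε hε => ?_⟩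
  have : Nontrivial E := nontrivial_of_ne x 0 hx
  have hR : 0 < 1 + ‖x‖ := by positivity
  obtain ⟨z₀, hz₀⟩ := exists_norm_eq E (by positivity : 0 ≤ (M + 1) * (1 + ‖x‖))
  obtain ⟨hint, hle⟩ := setIntegral_ball_kelvinGain_le (μ := μ) ha.le hα haα.le hM hx hε.1 hε.2 hz₀
  have hvol : μ.real (ball z₀ (1 + ‖x‖)) =
      (1 + ‖x‖) ^ (finrank ℝ E : ℝ) * μ.real (ball (0 : E) 1) := by
    rw [measureReal_def, Measure.addHaar_ball_of_pos _ _ hR, ENNReal.toReal_mul,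
      ENNReal.toReal_ofReal (by positivity), Real.rpow_natCast, measureReal_def]
  calc κ * μ.real (ball (0 : E) 1) / (M + 3) ^ α * (1 + ‖x‖) ^ (finrank ℝ E - a - α) =
        κ * (1 + ‖x‖) ^ (-a) / ((M + 3) * (1 + ‖x‖)) ^ α * μ.real (ball z₀ (1 + ‖x‖)) := by
        rw [hvol, Real.mul_rpow (by linarith) hR.le, Real.rpow_sub hR, Real.rpow_sub hR,
          Real.rpow_neg hR.le]
        field_simp
    _ ≤ _ := setIntegral_ge_of_const_le_real measurableSet_ball measure_ball_lt_top.ne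
        (fun z hz => le_kelvinGain_div_norm_sub_rpow ha.le haα.le
          ((Nat.cast_nonneg _).trans hα.le) hM (by linarith) hx hz₀ hz) hint
    _ ≤ _ := hle

end PowerProfile

section Supersolution

open MeasureTheory Metric Set Module

variable {N : ℕ} {s a : ℝ}

lemma contDiffAt_one_add_norm_rpow {E : Type*} [NormedAddCommGroup E] [InnerProductSpace ℝ E]
    {n : WithTop ℕ∞} {x : E} (hx : x ≠ 0) (a : ℝ) :
    ContDiffAt ℝ n (fun y : E => (1 + ‖y‖) ^ a) x :=
  (contDiffAt_const.add (contDiffAt_norm ℝ hx)).rpow_const_of_ne (by positivity)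

lemma exists_forall_hasFracLap_one_add_norm_rpow_neg (hs₀ : 0 < s) (hs₁ : s < 1) (ha : 0 < a)
    (haN : a < N - 2 * s) :
    ∃ c : ℝ, 0 < c ∧ ∀ x : EuclideanSpace ℝ (Fin N), x ≠ 0 → ∃ L : ℝ,
      HasFracLap s (fun y => (1 + ‖y‖) ^ (-a)) x L ∧ c * (1 + ‖x‖) ^ (-a - 2 * s) ≤ L := by
  have : NeZero N := ⟨by rintro rfl; norm_num at haN; linarith⟩
  have hC := fracLapConst_pos N hs₀ hs₁
  obtain ⟨c, hc, hle⟩ := exists_forall_le_setIntegral_sub_div_norm_sub_rpow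
    (volume : Measure (EuclideanSpace ℝ (Fin N))) (α := N + 2 * s) ha (by simpa using hs₀)
    (by rw [finrank_euclideanSpace_fin]; linarith)
  refine ⟨fracLapConst N s * c, by positivity, fun x hx => ?_⟩
  obtain ⟨L, hL⟩ := exists_hasFracLap hs₀ hs₁ (Measurable.aestronglyMeasurable (by fun_prop))
    (abs_one_add_norm_rpow_neg_le_one ha.le) (contDiffAt_one_add_norm_rpow hx (-a))
  refine ⟨L, hL, ge_of_tendsto hL.2 ?_⟩
  filter_upwards [Ioc_mem_nhdsGT (half_pos (norm_pos_iff.2 hx))] with ε hε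
  rw [mul_assoc, show -a - 2 * s = N - a - (N + 2 * s) by ring]
  simpa using mul_le_mul_of_nonneg_left (hle x hx ε hε) hC.le

lemma exists_pos_forall_mul_rpow_eq {c p : ℝ} (hc : 0 < c) (hp : 1 < p) :
    ∃ C : ℝ, 0 < C ∧ ∀ t, 0 ≤ t → (C * t) ^ p = C * (c * t ^ p) := by
  have hC : 0 < c ^ (1 / (p - 1)) := by positivity
  have hpow : (c ^ (1 / (p - 1))) ^ p = c ^ (1 / (p - 1)) * c := by
    rw [← Real.rpow_mul hc.le, ← Real.rpow_add_one hc.ne']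
    congr 1
    field_simp [sub_ne_zero.2 hp.ne']
    ring
  exact ⟨_, hC, fun t ht => by rw [Real.mul_rpow hC.le ht, hpow, mul_assoc]⟩

lemma exists_const_isClassicalSupersolution {p : ℝ} (hs₀ : 0 < s) (hs₁ : s < 1) (ha : 0 < a)
    (haN : a < N - 2 * s) (hap : 2 * s ≤ a * (p - 1)) :
    ∃ C : ℝ, 0 < C ∧ ∀ q lam R₀ : ℝ, lam ≤ 1 → 0 < R₀ →
      IsClassicalSupersolution s q lam (fun t : ℝ => t ^ p) R₀
        (fun x : EuclideanSpace ℝ (Fin N) => C * (1 + ‖x‖) ^ (-a)) := by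
  have hp : 1 < p := sub_pos.1 (pos_of_mul_pos_right ((mul_pos two_pos hs₀).trans_le hap) ha.le)
  obtain ⟨c, hc, hfrac⟩ := exists_forall_hasFracLap_one_add_norm_rpow_neg hs₀ hs₁ ha haN
  obtain ⟨C, hC, hCp⟩ := exists_pos_forall_mul_rpow_eq hc hp
  refine ⟨C, hC, fun q lam R₀ hlam hR₀ => ?_⟩
  have hne : ∀ x ∈ (ball (0 : EuclideanSpace ℝ (Fin N)) R₀)ᶜ, x ≠ 0 := fun x hx =>
    (ne_of_mem_of_not_mem (mem_ball_self hR₀) hx).symm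
  refine ⟨?_, fun x hx => ?_, fun x hx => ?_⟩
  · refine memL2s_of_bounded hs₀ (M := C) (Measurable.aestronglyMeasurable (by fun_prop))
      fun x => ?_
    rw [abs_mul, abs_of_pos hC]
    exact mul_le_of_le_one_right hC.le (abs_one_add_norm_rpow_neg_le_one ha.le x)
  · exact contDiffAt_const.mul (contDiffAt_one_add_norm_rpow (hne x hx) (-a))
  · obtain ⟨L, hL, hcL⟩ := hfrac x (hne x hx)
    refine ⟨C * L, hL.const_mul C, ?_⟩
    have hdecay : ((1 + ‖x‖) ^ (-a)) ^ p ≤ (1 + ‖x‖) ^ (-a - 2 * s) := by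
      rw [← Real.rpow_mul (by positivity)]
      exact Real.rpow_le_rpow_of_exponent_le (by simp) (by linarith)
    calc lam * (C * (1 + ‖x‖) ^ (-a)) ^ p ≤ (C * (1 + ‖x‖) ^ (-a)) ^ p :=
          mul_le_of_le_one_left (by positivity) hlam
      _ = C * (c * ((1 + ‖x‖) ^ (-a)) ^ p) := hCp _ (by positivity)
      _ ≤ C * (c * (1 + ‖x‖) ^ (-a - 2 * s)) := by gcongr
      _ ≤ C * L := by gcongr
      _ ≤ C * L + ‖gradient (fun x : EuclideanSpace ℝ (Fin N) => C * (1 + ‖x‖) ^ (-a)) x‖ ^ q :=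
          le_add_of_nonneg_right (by positivity)

end Supersolution

theorem theorem4_general (N : ℕ) (s p : ℝ) (hs0 : 0 < s) (hs1 : s < 1) (hN : 2 * s < (N : ℝ))
    (hp : (N : ℝ) / ((N : ℝ) - 2 * s) < p) :
    (Set.Ioo (1 / (p - 1)) (((N : ℝ) - 2 * s) / (2 * s))).Nonempty ∧
    ∀ β ∈ Set.Ico (1 / (p - 1)) (((N : ℝ) - 2 * s) / (2 * s)),
      ∃ C : ℝ, 0 < C ∧
        (∀ x : EuclideanSpace ℝ (Fin N), 0 < C * (1 + ‖x‖) ^ (-(2 * s * β))) ∧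
        (∃ M : ℝ, ∀ x : EuclideanSpace ℝ (Fin N), C * (1 + ‖x‖) ^ (-(2 * s * β)) ≤ M) ∧
        ∀ q lam R₀ : ℝ, lam ≤ 1 → 0 < R₀ →
          IsClassicalSupersolution s q lam (fun t : ℝ => t ^ p) R₀
            (fun x : EuclideanSpace ℝ (Fin N) => C * (1 + ‖x‖) ^ (-(2 * s * β))) := by
  have hγ : 0 < (N : ℝ) - 2 * s := sub_pos.2 hN
  have h2s : 0 < 2 * s := by positivity
  have hp₁ : 0 < p - 1 :=
    sub_pos.2 (((one_le_div hγ).2 (by linarith)).trans_lt hp)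
  rw [div_lt_iff₀ hγ] at hp
  refine ⟨Set.nonempty_Ioo.2 ((div_lt_div_iff₀ hp₁ h2s).2 (by linarith)), fun β ⟨hβp, hβN⟩ => ?_⟩
  have hβ : 0 < β := (one_div_pos.2 hp₁).trans_le hβp
  rw [div_le_iff₀ hp₁] at hβp
  rw [lt_div_iff₀' h2s] at hβN
  have ha : 0 < 2 * s * β := by positivity
  obtain ⟨C, hC, h⟩ := exists_const_isClassicalSupersolution (N := N) (p := p) hs0 hs1 ha hβN
    (by rw [mul_assoc]; exact le_mul_of_one_le_right h2s.le hβp)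
  exact ⟨C, hC, fun x => by positivity, ⟨C, fun x => mul_le_of_le_one_right hC.le
    (le_of_abs_le (abs_one_add_norm_rpow_neg_le_one ha.le x))⟩, h⟩

theorem theorem4 (N : ℕ) (s p : ℝ) (hs0 : 0 < s) (hs1 : s < 1) (hN : 2 * s < (N : ℝ))
    (hp : (N : ℝ) / ((N : ℝ) - 2 * s) < p) :
    (∃ u : EuclideanSpace ℝ (Fin N) → ℝ,
      (∀ x, 0 < u x) ∧ (∃ M : ℝ, ∀ x, u x ≤ M) ∧
      ∀ q lam R₀ : ℝ, 0 ≤ q → lam ≤ 1 → 0 < R₀ →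
        IsClassicalSupersolution s q lam (fun t : ℝ => t ^ p) R₀ u) ∧
    (Set.Ioo (1 / (p - 1)) (((N : ℝ) - 2 * s) / (2 * s))).Nonempty ∧
    ∀ β ∈ Set.Ioo (1 / (p - 1)) (((N : ℝ) - 2 * s) / (2 * s)),
      ∃ C : ℝ, 0 < C ∧
        (∀ x : EuclideanSpace ℝ (Fin N), 0 < C * (1 + ‖x‖) ^ (-(2 * s * β))) ∧
        (∃ M : ℝ, ∀ x : EuclideanSpace ℝ (Fin N), C * (1 + ‖x‖) ^ (-(2 * s * β)) ≤ M) ∧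
        ∀ q lam R₀ : ℝ, 0 ≤ q → lam ≤ 1 → 0 < R₀ →
          IsClassicalSupersolution s q lam (fun t : ℝ => t ^ p) R₀
            (fun x : EuclideanSpace ℝ (Fin N) => C * (1 + ‖x‖) ^ (-(2 * s * β))) := by
  obtain ⟨hne, h⟩ := theorem4_general N s p hs0 hs1 hN hp
  obtain ⟨β, hβ⟩ := hne
  obtain ⟨C, -, hpos, hbdd, hsup⟩ := h β (Set.Ioo_subset_Ico_self hβ)
  refine ⟨⟨_, hpos, hbdd, fun q lam R₀ _ => hsup q lam R₀⟩, ⟨β, hβ⟩, fun β hβ => ?_⟩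
  obtain ⟨C, hC, hpos, hbdd, hsup⟩ := h β (Set.Ioo_subset_Ico_self hβ)
  exact ⟨C, hC, hpos, hbdd, fun q lam R₀ _ => hsup q lam R₀⟩
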